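/- Let $G$ be a connected matrix Lie group, that is, a connected closed subgroup of $GL(n,\mathbb{C})$, equipped with a bi-invariant Riemannian metric, and let $\mathfrak g = T_eG$ be its Lie algebra, with the Lie exponential $\exp : \mathfrak g \to G$ given by the exponential of matrices. For an endomorphism $T$ of $\mathfrak g$ put $\phi(T) = \sum_{k\ge 0} \frac{(-T)^k}{(k+1)!}$, and let $\mathrm{ad}_X(Y) = XY - YX$. For $A \in \mathfrak g$ define $$\widehat r_A : T_{e^A}G \to G, \qquad \widehat r_A(U) = \exp\bigl(A + \phi(\mathrm{ad}_{-A})(e^{-A}U)\bigr),$$ the step-update map $\widehat r(e^A, U) = \widehat r_A(U)$ induced by gradient descent through the exponential parametrization. A map $r : TG \to G$, $(B,U) \mapsto r_B(U)$, is called a retraction if $r_B(0) = B$ and $(\mathrm{d} r_B)_0 = \mathrm{Id}_{T_BG}$ for all $B \in G$. Then $\widehat r$ is a retraction if and only if $G$ is abelian, and if and only if $\exp$ is a local isometry. This holds for every reading of the formula for $\widehat r$ when $B \in G$ has several logarithms; precisely, the following are equivalent: 1. $G$ is abelian; 2. for every $A \in \mathfrak g$, $\widehat r_A(0) = e^A$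 and $(\mathrm{d}\widehat r_A)_0 = \mathrm{Id}_{T_{e^A}G}$; 3. there is a retraction $r : TG \to G$ with $r_{e^A} = \widehat r_A$ for every $A \in \mathfrak g$; 4. there is a retraction $r : TG \to G$ such that every $B \in G$ has a logarithm $A \in \mathfrak g$, $e^A = B$, with $r_B = \widehat r_A$; 5. the Lie exponential $\exp$ is a local isometry from $\mathfrak g$, with the inner product given by the metric at the identity, to $G$ (that is, a local diffeomorphism at every point whose differential respects the metrics). -/

import Mathlib

open Filter
open scoped Topology ContDiff Nat

/- The norm on complex matrices serves only to fix the (unique) finite-dimensional topology. -/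
attribute [local instance] Matrix.linftyOpNormedRing Matrix.linftyOpNormedAlgebra

/-!
The definitions are written for a closed subgroup `G` of the unit group of a finite-dimensional
real algebra `M`; the case of interest is `M = M_n(ℂ)`, whose unit group is `GL(n, ℂ)`.
A closed subgroup is an embedded submanifold of `M`, so tangent vectors, differentials and
smoothness are those of embedded submanifolds, computed in `M`.
-/

namespace MatrixLieGroup

/-- The inclusion of the group into the ambient matrix algebra. -/
def toMat {M : Type*} [NormedRing M] {G : ClosedSubgroup Mˣ} (g : G) : M := ((g : Mˣ) : M)

section basic

variable {M : Type*} [NormedRing M] {G : ClosedSubgroup Mˣ}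

@[simp] theorem toMat_one : toMat (1 : G) = 1 := rfl

@[simp] theorem toMat_mul (g h : G) : toMat (g * h) = toMat g * toMat h := rfl

theorem toMat_mul_inv (g : G) : toMat g * toMat g⁻¹ = 1 := by
  rw [← toMat_mul, mul_inv_cancel, toMat_one]

theorem toMat_inv_mul (g : G) : toMat g⁻¹ * toMat g = 1 := by
  rw [← toMat_mul, inv_mul_cancel, toMat_one]

end basic

variable {M : Type*} [NormedRing M] [NormedAlgebra ℝ M]

/-- The tangent space `T_B G`: velocities at time `0` of the smooth curves in `G` through `B`. -/
def tangentSpace (G : ClosedSubgroup Mˣ) (B : G) : Submodule ℝ M where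
  carrier := {X | ∃ γ : ℝ → G, ContDiff ℝ ∞ (fun t => toMat (γ t)) ∧ γ 0 = B ∧
    HasDerivAt (fun t => toMat (γ t)) X 0}
  zero_mem' := ⟨fun _ => B, contDiff_const, rfl, hasDerivAt_const _ _⟩
  add_mem' := by
    rintro X Y ⟨γ, hγ, hγ0, hX⟩ ⟨δ, hδ, hδ0, hY⟩
    refine ⟨fun t => γ t * B⁻¹ * δ t, ?_, by simp [hγ0, hδ0], ?_⟩
    · exact (hγ.mul (contDiff_const (c := toMat B⁻¹))).mul hδ
    · have h := (hX.mul_const (toMat B⁻¹)).mul hY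
      have e : X * toMat B⁻¹ * toMat (δ 0) + toMat (γ 0) * toMat B⁻¹ * Y = X + Y := by
        rw [hγ0, hδ0, mul_assoc, toMat_inv_mul, toMat_mul_inv, mul_one, one_mul]
      rw [e] at h
      exact h
  smul_mem' := by
    rintro c X ⟨γ, hγ, hγ0, hX⟩
    refine ⟨fun t => γ (c * t), hγ.comp (contDiff_const.mul contDiff_id), by simp [hγ0], ?_⟩
    have h1 : HasDerivAt (fun t : ℝ => c * t) c 0 := by
      simpa using (hasDerivAt_id (0 : ℝ)).const_mul c
    have h2 : HasDerivAt (fun t => toMat (γ t)) X (c * 0) := by simpa using hX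
    exact h2.scomp (0 : ℝ) h1

/-- The Lie algebra `𝔤 = T_e G`. -/
abbrev lieAlg (G : ClosedSubgroup Mˣ) : Submodule ℝ M := tangentSpace G 1

section translations

variable {G : ClosedSubgroup Mˣ}

theorem mul_mul_mem_tangentSpace (g B h : G) {X : M} (hX : X ∈ tangentSpace G B) :
    toMat g * X * toMat h ∈ tangentSpace G (g * B * h) := by
  obtain ⟨γ, hγ, hγ0, hd⟩ := hX
  refine ⟨fun t => g * γ t * h, ?_, by simp [hγ0], ?_⟩
  · exact ((contDiff_const (c := toMat g)).mul hγ).mul (contDiff_const (c := toMat h))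
  · exact (hd.const_mul (toMat g)).mul_const (toMat h)

/-- The differential `X ↦ g X` at `B` of the left translation `L_g`. -/
def leftTranslate (g B : G) (X : tangentSpace G B) : tangentSpace G (g * B) :=
  ⟨toMat g * X, by simpa using mul_mul_mem_tangentSpace g B 1 X.2⟩

/-- The differential `X ↦ X g` at `B` of the right translation `R_g`. -/
def rightTranslate (g B : G) (X : tangentSpace G B) : tangentSpace G (B * g) :=
  ⟨(X : M) * toMat g, by simpa using mul_mul_mem_tangentSpace 1 B g X.2⟩

/-- The identification `U ↦ B⁻¹ U` of `T_B G` with the Lie algebra. -/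
def toLieAlg (B : G) (U : tangentSpace G B) : lieAlg G :=
  ⟨toMat B⁻¹ * U, by simpa using mul_mul_mem_tangentSpace B⁻¹ B 1 U.2⟩

end translations

/-- A smooth Riemannian metric on `G`: a family of inner products on the tangent spaces which
locally extends to a smooth family of bilinear forms on the ambient algebra. -/
structure RiemannianMetric (G : ClosedSubgroup Mˣ) where
  /-- the bilinear form on `T_B G` -/
  inner (B : G) : tangentSpace G B →ₗ[ℝ] tangentSpace G B →ₗ[ℝ] ℝ
  symm (B : G) (X Y : tangentSpace G B) : inner B X Y = inner B Y X
  pos (B : G) (X : tangentSpace G B) (hX : X ≠ 0) : 0 < inner B X X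
  smooth (B : G) : ∃ β : M → M →L[ℝ] M →L[ℝ] ℝ, ContDiffAt ℝ ∞ β (toMat B) ∧
    ∀ᶠ C in 𝓝 B, ∀ X Y : tangentSpace G C, inner C X Y = β (toMat C) X Y

/-- The metric is left and right invariant. -/
def RiemannianMetric.IsBiInvariant {G : ClosedSubgroup Mˣ} (α : RiemannianMetric G) : Prop :=
  (∀ (g B : G) (X Y : tangentSpace G B),
    α.inner (g * B) (leftTranslate g B X) (leftTranslate g B Y) = α.inner B X Y) ∧
  (∀ (g B : G) (X Y : tangentSpace G B),
    α.inner (B * g) (rightTranslate g B X) (rightTranslate g B Y) = α.inner B X Y)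

section finiteDimensional

variable [FiniteDimensional ℝ M] {G : ClosedSubgroup Mˣ}

theorem commutator_mem_lieAlg {X Y : M} (hX : X ∈ lieAlg G) (hY : Y ∈ lieAlg G) :
    X * Y - Y * X ∈ lieAlg G := by
  have : CompleteSpace M := FiniteDimensional.complete ℝ M
  obtain ⟨γ, hγ, hγ0, hd⟩ := hX
  have hinv : HasDerivAt (fun t => toMat (γ t)⁻¹) (-X) 0 := by
    have hR := (contDiffAt_ringInverse ℝ (n := 1) ((γ 0 : G) : Mˣ)).differentiableAt (by simp)
    have h0 : DifferentiableAt ℝ (fun t => toMat (γ t)⁻¹) 0 := by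
      have hc := DifferentiableAt.comp (0 : ℝ) (f := fun t => toMat (γ t)) hR hd.differentiableAt
      have e : (Ring.inverse ∘ fun t => toMat (γ t)) = fun t => toMat (γ t)⁻¹ := by
        funext t
        exact Ring.inverse_unit ((γ t : G) : Mˣ)
      rwa [e] at hc
    have h1 := hd.mul h0.hasDerivAt
    have h2 : ((fun t => toMat (γ t)) * fun t => toMat (γ t)⁻¹) = fun _ => (1 : M) := by
      funext t
      exact toMat_mul_inv (γ t)
    rw [h2] at h1
    have h3 := h1.unique (hasDerivAt_const (0 : ℝ) (1 : M))
    rw [hγ0, inv_one, toMat_one, mul_one, one_mul] at h3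
    have h4 := h0.hasDerivAt
    rwa [← neg_eq_of_add_eq_zero_right h3] at h4
  have hAd : HasDerivAt (fun t => toMat (γ t) * Y * toMat (γ t)⁻¹) (X * Y - Y * X) 0 := by
    have h := (hd.mul_const Y).mul hinv
    have e : X * Y * toMat (γ 0)⁻¹ + toMat (γ 0) * Y * -X = X * Y - Y * X := by
      rw [hγ0, inv_one, toMat_one]
      noncomm_ring
    rw [e] at h
    exact h
  have hmem : ∀ t, toMat (γ t) * Y * toMat (γ t)⁻¹ ∈ lieAlg G := fun t => by
    simpa using mul_mul_mem_tangentSpace (γ t) 1 (γ t)⁻¹ hY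
  have hcl : IsClosed (lieAlg G : Set M) := (lieAlg G).closed_of_finiteDimensional
  refine hcl.mem_of_tendsto (hasDerivAt_iff_tendsto_slope.1 hAd) (Eventually.of_forall fun t => ?_)
  exact (lieAlg G).smul_mem _ ((lieAlg G).sub_mem (hmem t) (hmem 0))

/-- The adjoint representation `ad_X Y = X Y - Y X` of `𝔤`. -/
def ad (X : lieAlg G) : Module.End ℝ (lieAlg G) where
  toFun Y := ⟨(X : M) * Y - Y * X, commutator_mem_lieAlg X.2 Y.2⟩
  map_add' Y Z := by
    ext
    simp only [Submodule.coe_add]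
    noncomm_ring
  map_smul' c Y := by
    ext
    simp [smul_sub]

/-- The function `φ(T) = (1 - e^{-T}) / T = ∑ₖ (-T)ᵏ / (k+1)!` of an endomorphism `T` of `𝔤`,
evaluated at `Y ∈ 𝔤` (the series always converges, as `𝔤` is finite-dimensional). -/
noncomputable def phi (T : Module.End ℝ (lieAlg G)) (Y : lieAlg G) : lieAlg G :=
  ∑' k : ℕ, (((k + 1)! : ℕ) : ℝ)⁻¹ • ((-T) ^ k) Y

end finiteDimensional

/-! ### The exponential maps the Lie algebra into the group -/

section limit

variable {N : Type*} [NormedRing N] [NormOneClass N]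

theorem norm_pow_sub_pow_le {a b : N} {m : ℝ} (hm : 1 ≤ m) (ha : ‖a‖ ≤ m)
    (hb : ‖b‖ ≤ m) (k : ℕ) : ‖a ^ k - b ^ k‖ ≤ k * m ^ k * ‖a - b‖ := by
  induction k with
  | zero => simp
  | succ k ih =>
    have e : a ^ (k + 1) - b ^ (k + 1) = a * (a ^ k - b ^ k) + (a - b) * b ^ k := by
      rw [pow_succ', pow_succ']; noncomm_ring
    have hbk : ‖b ^ k‖ ≤ m ^ k := (norm_pow_le b k).trans (by gcongr)
    have hmk : m ^ k ≤ m ^ (k + 1) := pow_le_pow_right₀ hm (Nat.le_succ k)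
    calc ‖a ^ (k + 1) - b ^ (k + 1)‖
        ≤ ‖a‖ * ‖a ^ k - b ^ k‖ + ‖a - b‖ * ‖b ^ k‖ := by
          rw [e]
          exact (norm_add_le _ _).trans (add_le_add (norm_mul_le _ _) (norm_mul_le _ _))
      _ ≤ m * (k * m ^ k * ‖a - b‖) + ‖a - b‖ * m ^ (k + 1) := by gcongr; exact hbk.trans hmk
      _ = ((k + 1 : ℕ) : ℝ) * m ^ (k + 1) * ‖a - b‖ := by push_cast; ring

variable [NormedAlgebra ℝ N]

theorem eventually_norm_le {γ : ℝ → N} {X : N} (h0 : γ 0 = 1) (hd : HasDerivAt γ X 0) :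
    ∀ᶠ k : ℕ in atTop, ‖γ (k : ℝ)⁻¹‖ ≤ 1 + (‖X‖ + 1) / k := by
  have ho := hd.isLittleO
  have h1 := (tendsto_inv_atTop_nhds_zero_nat (𝕜 := ℝ)).eventually (ho.def one_pos)
  filter_upwards [h1] with k hk
  simp only [h0, sub_zero, one_mul] at hk
  have h2 : ‖((k : ℝ)⁻¹)‖ = (k : ℝ)⁻¹ := by simp
  calc ‖γ (k : ℝ)⁻¹‖ = ‖(γ (k : ℝ)⁻¹ - 1 - (k : ℝ)⁻¹ • X) + 1 + (k : ℝ)⁻¹ • X‖ := by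
        congr 1; abel
    _ ≤ ‖γ (k : ℝ)⁻¹ - 1 - (k : ℝ)⁻¹ • X‖ + ‖(1 : N)‖ + ‖(k : ℝ)⁻¹ • X‖ := norm_add₃_le
    _ ≤ (k : ℝ)⁻¹ + 1 + (k : ℝ)⁻¹ * ‖X‖ := by
        rw [norm_smul, h2, norm_one]; rw [h2] at hk; gcongr
    _ = 1 + (‖X‖ + 1) / k := by ring

theorem tendsto_curve_pow [CompleteSpace N] {γ : ℝ → N} {X : N} (h0 : γ 0 = 1)
    (hd : HasDerivAt γ X 0) :
    Tendsto (fun k : ℕ => γ (k : ℝ)⁻¹ ^ k) atTop (𝓝 (NormedSpace.exp X)) := by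
  let _ : NormedAlgebra ℚ N := NormedAlgebra.restrictScalars ℚ ℝ N
  set β : ℝ → N := fun t => NormedSpace.exp (t • X) with hβ
  have hβ0 : β 0 = 1 := by simp [hβ]
  have hβd : HasDerivAt β X 0 := by
    simpa using hasDerivAt_exp_smul_const (𝕂 := ℝ) X (0 : ℝ)
  have hsub : HasDerivAt (fun t => γ t - β t) 0 0 := by
    have h := hd.sub hβd
    rw [sub_self] at h
    exact h
  have ho : Tendsto (fun k : ℕ => (k : ℝ) * ‖γ (k : ℝ)⁻¹ - β (k : ℝ)⁻¹‖) atTop (𝓝 0) := by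
    have h1 := hsub.isLittleO
    simp only [h0, hβ0, sub_self, sub_zero, smul_zero] at h1
    have h2 := (h1.comp_tendsto (tendsto_inv_atTop_nhds_zero_nat (𝕜 := ℝ))).norm_norm
    have h3 := h2.tendsto_div_nhds_zero
    refine h3.congr fun k => ?_
    simp [div_eq_mul_inv, mul_comm]
  have hpow : ∀ᶠ k : ℕ in atTop, ‖γ (k : ℝ)⁻¹ ^ k - NormedSpace.exp X‖ ≤
      Real.exp (‖X‖ + 1) * ((k : ℝ) * ‖γ (k : ℝ)⁻¹ - β (k : ℝ)⁻¹‖) := by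
    filter_upwards [eventually_norm_le h0 hd, eventually_norm_le hβ0 hβd,
      eventually_ge_atTop 1] with k ha hb hk
    have hk0 : (k : ℝ) ≠ 0 := by positivity
    have hm : (1 : ℝ) ≤ 1 + (‖X‖ + 1) / k := by
      have : 0 ≤ (‖X‖ + 1) / k := by positivity
      linarith
    have hβk : β (k : ℝ)⁻¹ ^ k = NormedSpace.exp X := by
      rw [hβ]
      simp only
      rw [← NormedSpace.exp_nsmul, ← Nat.cast_smul_eq_nsmul ℝ, smul_smul, mul_inv_cancel₀ hk0,
        one_smul]
    have hmk : (1 + (‖X‖ + 1) / (k : ℝ)) ^ k ≤ Real.exp (‖X‖ + 1) := by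
      calc (1 + (‖X‖ + 1) / (k : ℝ)) ^ k ≤ Real.exp ((‖X‖ + 1) / k) ^ k := by
            gcongr; rw [add_comm]; exact Real.add_one_le_exp _
        _ = Real.exp (‖X‖ + 1) := by
            rw [← Real.exp_nat_mul]; congr 1; field_simp
    have h := norm_pow_sub_pow_le hm ha hb k
    rw [hβk] at h
    refine h.trans ?_
    rw [mul_comm (k : ℝ), mul_assoc]
    gcongr
  rw [tendsto_iff_norm_sub_tendsto_zero]
  exact squeeze_zero' (Eventually.of_forall fun _ => norm_nonneg _) hpow
    (by simpa using ho.const_mul (Real.exp (‖X‖ + 1)))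

end limit

section finiteDimensional

variable [FiniteDimensional ℝ M]

theorem exp_mul_exp_neg (X : M) : NormedSpace.exp X * NormedSpace.exp (-X) = 1 := by
  have : CompleteSpace M := FiniteDimensional.complete ℝ M
  let _ : NormedAlgebra ℚ M := NormedAlgebra.restrictScalars ℚ ℝ M
  rw [← NormedSpace.exp_add_of_commute (Commute.refl X).neg_right, add_neg_cancel,
    NormedSpace.exp_zero]

/-- The matrix exponential `e^X = ∑ₖ Xᵏ / k!`, as an invertible matrix. -/
noncomputable def expUnit (X : M) : Mˣ where
  val := NormedSpace.exp X
  inv := NormedSpace.exp (-X)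
  val_inv := exp_mul_exp_neg X
  inv_val := by simpa using exp_mul_exp_neg (-X)

variable {G : ClosedSubgroup Mˣ}

theorem expUnit_mem (X : lieAlg G) : expUnit (X : M) ∈ G := by
  rcases subsingleton_or_nontrivial M with hM | hM
  · rw [Subsingleton.elim (expUnit (X : M)) 1]
    exact one_mem G
  have : CompleteSpace M := FiniteDimensional.complete ℝ M
  let _ : NormedAlgebra ℚ M := NormedAlgebra.restrictScalars ℚ ℝ M
  let _ : NormedAlgebra ℚ (M →L[ℝ] M) := NormedAlgebra.restrictScalars ℚ ℝ (M →L[ℝ] M)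
  obtain ⟨γ, -, hγ0, hd⟩ := X.2
  let L : M →+* (M →L[ℝ] M) :=
    { ContinuousLinearMap.mul ℝ M with
      map_one' := by ext; simp
      map_mul' := fun a b => by ext; simp [mul_assoc]
      map_zero' := by simp }
  have hL : Continuous L := (ContinuousLinearMap.mul ℝ M).continuous
  have hdL : HasDerivAt (fun t => L (toMat (γ t))) (L X) 0 :=
    (ContinuousLinearMap.mul ℝ M).hasFDerivAt.comp_hasDerivAt (0 : ℝ) hd
  have h1 := tendsto_curve_pow (by rw [hγ0, toMat_one, map_one]) hdL
  rw [← NormedSpace.map_exp L hL] at h1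
  have h2 : Tendsto (fun k : ℕ => L (toMat (γ (k : ℝ)⁻¹) ^ k) 1) atTop
      (𝓝 (L (NormedSpace.exp (X : M)) 1)) := by
    simp only [map_pow]
    exact ((ContinuousLinearMap.apply ℝ M (1 : M)).continuous.tendsto _).comp h1
  have hL1 : ∀ a : M, L a 1 = a := fun a => mul_one a
  simp only [hL1] at h2
  have hcl : IsClosed (G : Set Mˣ) := G.isClosed'
  refine hcl.mem_of_tendsto (b := atTop) (f := fun k : ℕ => ((γ (k : ℝ)⁻¹ ^ k : G) : Mˣ)) ?_
    (Eventually.of_forall fun k => (γ (k : ℝ)⁻¹ ^ k).2)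
  rw [Units.isOpenEmbedding_val.isInducing.tendsto_nhds_iff]
  exact h2.congr fun k => by simp [toMat]

/-- The Lie exponential `exp : 𝔤 → G`. -/
noncomputable def lieExp (X : lieAlg G) : G := ⟨expUnit (X : M), expUnit_mem X⟩

/-- The step-update map over `e^A`, for a given `A ∈ 𝔤`:
`r̂(e^A, U) = exp (A + φ(ad_{-A}) (e^{-A} U))` for `U ∈ T_{e^A} G`. -/
noncomputable def stepUpdate (A : lieAlg G) (U : tangentSpace G (lieExp A)) : G :=
  lieExp (A + phi (ad (-A)) (toLieAlg (lieExp A) U))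

/-- A map `f : T_B G → G` is a retraction at `B` if `f 0 = B` and `(df)_0 = Id`, where
`T_B G` is included in the ambient algebra. -/
def IsRetractionAt (B : G) (f : tangentSpace G B → G) : Prop :=
  f 0 = B ∧ HasFDerivAt (fun U => toMat (f U)) (tangentSpace G B).subtypeL 0

/-- A map `r : TG → G`, `(B, U) ↦ r_B(U)`, is a retraction if `r_B(0) = B` and `(d r_B)_0 = Id`
for every `B ∈ G`. -/
def IsRetraction (r : (B : G) → tangentSpace G B → G) : Prop :=
  ∀ B : G, IsRetractionAt B (r B)

/-- `f : 𝔤 → G` is a smooth local diffeomorphism at `A`: it restricts to a smooth bijection from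
an open neighbourhood `V` of `A` to an open set `W ⊆ G`, whose inverse is smooth, that is, locally
extends to a smooth map on the ambient algebra. -/
def IsLocalDiffeoAt (f : lieAlg G → G) (A : lieAlg G) : Prop :=
  ∃ (V : Set (lieAlg G)) (W : Set G), IsOpen V ∧ A ∈ V ∧ IsOpen W ∧ Set.BijOn f V W ∧
    ContDiffOn ℝ ∞ (fun X => toMat (f X)) V ∧
    ∃ ψ : M → lieAlg G, (∀ g ∈ W, ContDiffAt ℝ ∞ ψ (toMat g)) ∧ ∀ X ∈ V, ψ (toMat (f X)) = X

/-- `f : 𝔤 → G` is a local isometry from the Euclidean space `𝔤`, with the inner product given by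
the metric at the identity, to `G`: it is a local diffeomorphism, and its differential
`D = (df)_A : 𝔤 → T_{f(A)} G` respects the metric at every `A ∈ 𝔤`. -/
def IsLocalIsometry (α : RiemannianMetric G) (f : lieAlg G → G) : Prop :=
  ∀ A : lieAlg G, IsLocalDiffeoAt f A ∧
    ∃ D : lieAlg G →L[ℝ] tangentSpace G (f A),
      HasFDerivAt (fun X => toMat (f X)) ((tangentSpace G (f A)).subtypeL.comp D) A ∧
      ∀ X Y : lieAlg G, α.inner (f A) (D X) (D Y) = α.inner 1 X Y

end finiteDimensional

end MatrixLieGroup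

/-!
The proof rests on two facts about `T = ad_A`.

* *Metric.* By bi-invariance, `t ↦ Ad_{e^{tA}}` is a one-parameter group of isometries of the Lie
  algebra, with generator `T`; in particular `T` is skew. The curve `t ↦ Ad_{e^{tA}} Y` has constant
  speed `|T Y|`, so its chord `|e^T Y - Y|` between the times `0` and `1` is shorter than `|T Y|`
  unless the curve is constant. Hence `|e^T Y - Y| = |T Y|` forces `T Y = 0`
  (`eq_zero_of_norm_eq_chord`, `ad_eq_zero_of_inner_eq`).
* *Differential of `exp`.* Differentiating `exp (g⁻¹ A g) = g⁻¹ e^A g` in `g` gives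
  `(d exp)_A [A, Z] = e^A Z - Z e^A` (`fderiv_exp_commutator`). This is the formula for `d exp`
  on the range of `T`, and nothing more of it is needed.

If `exp` is isometric at `A`, the second fact gives `|T W| = |W - e^{-T} W| = |e^T W - W|`.
If `r̂_A` is a retraction at `e^A`, then `φ(-T)` inverts `e^{-A} (d exp)_A`; applied to `T² W`, with
`φ(-T) T = e^T - 1`, this becomes `T² = e^T + e^{-T} - 2`, and pairing with `W` gives
`|T W| = |e^T W - W|` again. Either way `ad_A = 0`. When every element of `G` has such a logarithm,
`G` is visibly abelian. When `ad_A = 0` for all `A`, the range of `exp` is a subgroup, which is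
open by the closed subgroup theorem (`nhds_one_le_map_lieExp`), hence all of `G` by connectedness,
and `G` is abelian.

Conversely, if `G` is abelian then `ad = 0` and `exp (A + X) = e^A e^X`. So `r̂_A (U)` is
`e^A exp (e^{-A} U)`, which depends on `e^A` only and is a retraction, and `exp` is near every `A`
a left translate of its restriction to a neighbourhood of `0`, where it is a diffeomorphism onto an
open subset of `G`, again by the closed subgroup theorem.
-/

namespace MatrixLieGroup

open NormedSpace

/-! ### The inclusion of the group into the ambient algebra -/

section general

variable {M : Type*} [NormedRing M] {G : ClosedSubgroup Mˣ}

theorem toMat_injective : Function.Injective (toMat : G → M) := fun _ _ h =>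
  Subtype.ext (Units.ext h)

instance : IsTopologicalGroup G := inferInstanceAs (IsTopologicalGroup G.toSubgroup)

variable [NormedAlgebra ℝ M]

/-- Two commuting families of curves have commuting velocities. -/
theorem lieAlg_comm_of_mul_comm (hG : ∀ g h : G, g * h = h * g) (X Y : lieAlg G) :
    (X : M) * Y = Y * X := by
  obtain ⟨γ, -, -, hγ⟩ := X.2
  obtain ⟨δ, -, -, hδ⟩ := Y.2
  have h1 : ∀ t, toMat (γ t) * (Y : M) = Y * toMat (γ t) := fun t => by
    refine (hδ.const_mul (toMat (γ t))).unique ?_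
    simp_rw [← toMat_mul, hG (γ t), toMat_mul]
    exact hδ.mul_const _
  refine (hγ.mul_const (Y : M)).unique ?_
  simp_rw [h1]
  exact hγ.const_mul _

end general

variable {M : Type*} [NormedRing M] [NormedAlgebra ℝ M] [FiniteDimensional ℝ M]

/-! ### The exponential of a finite-dimensional real algebra -/

theorem exp_add_of_comm {X Y : M} (h : X * Y = Y * X) : exp (X + Y) = exp X * exp Y := by
  have : CompleteSpace M := FiniteDimensional.complete ℝ M
  let _ : NormedAlgebra ℚ M := NormedAlgebra.restrictScalars ℚ ℝ M
  exact exp_add_of_commute h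

theorem contDiff_exp {n : WithTop ℕ∞} : ContDiff ℝ n (exp : M → M) := by
  have : CompleteSpace M := FiniteDimensional.complete ℝ M
  exact contDiff_iff_contDiffAt.2 fun X => (exp_analytic (𝕂 := ℝ) X).contDiffAt

theorem differentiableAt_exp (X : M) : DifferentiableAt ℝ (exp : M → M) X :=
  (contDiff_exp (n := 1)).differentiable (by simp) X

theorem hasDerivAt_exp_smul (X : M) (t : ℝ) :
    HasDerivAt (fun s : ℝ => exp (s • X)) (exp (t • X) * X) t := by
  have : CompleteSpace M := FiniteDimensional.complete ℝ M
  exact hasDerivAt_exp_smul_const (𝕂 := ℝ) X t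

theorem hasDerivAt_exp_smul_zero (X : M) : HasDerivAt (fun s : ℝ => exp (s • X)) X 0 := by
  simpa using hasDerivAt_exp_smul X 0

theorem contDiff_exp_smul (X : M) : ContDiff ℝ ∞ (fun s : ℝ => exp (s • X)) :=
  contDiff_exp.comp (contDiff_id.smul contDiff_const)

theorem continuous_expUnit : Continuous (expUnit : M → Mˣ) := by
  have : CompleteSpace M := FiniteDimensional.complete ℝ M
  rw [Units.isOpenEmbedding_val.isInducing.continuous_iff]
  exact (contDiff_exp (M := M) (n := 0)).continuous

theorem expUnit_add {X Y : M} (h : X * Y = Y * X) :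
    expUnit (X + Y) = expUnit X * expUnit Y :=
  Units.ext (exp_add_of_comm h)

theorem expUnit_zero : expUnit (0 : M) = 1 := Units.ext exp_zero

theorem expUnit_neg (X : M) : expUnit (-X) = (expUnit X)⁻¹ := Units.ext rfl

theorem expUnit_nsmul (n : ℕ) (X : M) : expUnit ((n : ℝ) • X) = expUnit X ^ n := by
  induction n with
  | zero => simp [expUnit_zero]
  | succ n ih =>
    rw [pow_succ, ← ih, ← expUnit_add (by simp), Nat.cast_succ, add_smul, one_smul]

theorem expUnit_zsmul (n : ℤ) (X : M) : expUnit ((n : ℝ) • X) = expUnit X ^ n := by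
  obtain ⟨k, rfl | rfl⟩ := n.eq_nat_or_neg
  · simpa using expUnit_nsmul k X
  · rw [Int.cast_neg, neg_smul, expUnit_neg, zpow_neg]
    simpa using expUnit_nsmul k X

variable {G : ClosedSubgroup Mˣ}

theorem isInducing_toMat : Topology.IsInducing (toMat : G → M) := by
  have : CompleteSpace M := FiniteDimensional.complete ℝ M
  exact Units.isOpenEmbedding_val.isInducing.comp Topology.IsInducing.subtypeVal

theorem toMat_lieExp (X : lieAlg G) : toMat (lieExp X) = exp (X : M) := rfl

theorem lieExp_zero : lieExp (0 : lieAlg G) = 1 := toMat_injective exp_zero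

theorem lieExp_add {X Y : lieAlg G} (h : (X : M) * Y = Y * X) :
    lieExp (X + Y) = lieExp X * lieExp Y :=
  toMat_injective (exp_add_of_comm h)

theorem lieExp_neg (X : lieAlg G) : lieExp (-X) = (lieExp X)⁻¹ :=
  Subtype.ext (expUnit_neg (X : M))

/-! ### Closed subgroups are submanifolds -/

theorem mem_lieAlg_of_expUnit_smul_mem {Y : M} (h : ∀ t : ℝ, expUnit (t • Y) ∈ G) :
    Y ∈ lieAlg G :=
  ⟨fun t => ⟨expUnit (t • Y), h t⟩, contDiff_exp_smul Y,
    Subtype.ext (by simp [expUnit_zero]), hasDerivAt_exp_smul_zero Y⟩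

/-- A direction in which arbitrarily small vectors exponentiate into the closed subgroup `G`
is tangent to `G`. -/
theorem mem_lieAlg_of_tendsto {y : ℕ → M} {Y : M} (h0 : ∀ k, y k ≠ 0)
    (hy : Tendsto y atTop (𝓝 0)) (hG : ∀ k, expUnit (y k) ∈ G)
    (hY : Tendsto (fun k => ‖y k‖⁻¹ • y k) atTop (𝓝 Y)) : Y ∈ lieAlg G := by
  refine mem_lieAlg_of_expUnit_smul_mem fun t => ?_
  have hr : Tendsto (fun k => (⌊t / ‖y k‖⌋ : ℝ) * ‖y k‖) atTop (𝓝 t) := by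
    have hn : Tendsto (fun k => ‖y k‖) atTop (𝓝 0) := by simpa using hy.norm
    refine tendsto_of_tendsto_of_tendsto_of_le_of_le (g := fun k => t - ‖y k‖) (h := fun _ => t)
      (by simpa using tendsto_const_nhds.sub hn) tendsto_const_nhds (fun k => ?_) fun k => ?_
    · have hk : 0 < ‖y k‖ := norm_pos_iff.2 (h0 k)
      have h1 : t / ‖y k‖ - 1 < ⌊t / ‖y k‖⌋ := Int.sub_one_lt_floor _
      calc t - ‖y k‖ = (t / ‖y k‖ - 1) * ‖y k‖ := by field_simp
        _ ≤ _ := by gcongr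
    · have hk : 0 < ‖y k‖ := norm_pos_iff.2 (h0 k)
      exact (le_div_iff₀ hk).1 (Int.floor_le _)
  have h1 : Tendsto (fun k => (⌊t / ‖y k‖⌋ : ℝ) • y k) atTop (𝓝 (t • Y)) := by
    refine (hr.smul hY).congr fun k => ?_
    have hk : ‖y k‖ ≠ 0 := norm_ne_zero_iff.2 (h0 k)
    rw [smul_smul, mul_assoc, mul_inv_cancel₀ hk, mul_one]
  have hcl : IsClosed (G : Set Mˣ) := G.isClosed'
  refine hcl.mem_of_tendsto ((continuous_expUnit.tendsto _).comp h1)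
    (Eventually.of_forall fun k => ?_)
  simp only [Function.comp_apply, expUnit_zsmul]
  exact G.toSubgroup.zpow_mem (hG k) _

/-- On a subspace transverse to `𝔤`, only `0` exponentiates into `G`, locally. -/
theorem eventually_eq_zero_of_expUnit_mem {H : Submodule ℝ M} (hH : Disjoint (lieAlg G) H) :
    ∀ᶠ Y in 𝓝 (0 : M), Y ∈ H → expUnit Y ∈ G → Y = 0 := by
  by_contra hcon
  rw [not_eventually] at hcon
  obtain ⟨y, hy, hyp⟩ := Filter.exists_seq_forall_of_frequently hcon
  have h0 : ∀ k, y k ≠ 0 := fun k h => hyp k fun _ _ => h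
  have hyH : ∀ k, y k ∈ H := fun k => by by_contra h; exact hyp k fun h' => absurd h' h
  have hyG : ∀ k, expUnit (y k) ∈ G := fun k => by
    by_contra h; exact hyp k fun _ h' => absurd h' h
  have : ProperSpace M := FiniteDimensional.proper ℝ M
  obtain ⟨Y, hY, u, hu, hlim⟩ := (isCompact_sphere (0 : M) 1).tendsto_subseq
    (x := fun k => ‖y k‖⁻¹ • y k) fun k => by
      simp [norm_smul, inv_mul_cancel₀ (norm_ne_zero_iff.2 (h0 k))]
  have hYg : Y ∈ lieAlg G := mem_lieAlg_of_tendsto (fun k => h0 (u k))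
    (hy.comp hu.tendsto_atTop) (fun k => hyG (u k)) hlim
  have hYH : Y ∈ H := H.closed_of_finiteDimensional.mem_of_tendsto hlim
    (Eventually.of_forall fun k => H.smul_mem _ (hyH (u k)))
  have hY0 : Y = 0 := Submodule.disjoint_def.1 hH Y hYg hYH
  simp [hY0] at hY

/-- The Lie exponential is open at `0`. -/
theorem nhds_one_le_map_lieExp : 𝓝 (1 : G) ≤ map lieExp (𝓝 (0 : lieAlg G)) := by
  have : CompleteSpace M := FiniteDimensional.complete ℝ M
  obtain ⟨H, hH⟩ := (lieAlg G).exists_isCompl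
  -- in the coordinates `(X, Y) ↦ exp X * exp Y` of `M`, the group is locally `Y = 0`
  let Φ : lieAlg G × H → M := fun p => exp (p.1 : M) * exp (p.2 : M)
  let e := (Submodule.prodEquivOfIsCompl _ _ hH).toContinuousLinearEquiv
  have hΦ : HasStrictFDerivAt Φ (e : (lieAlg G × H) →L[ℝ] M) 0 := by
    have h1 : HasStrictFDerivAt (fun p : lieAlg G × H => exp (p.1 : M))
        ((lieAlg G).subtypeL.comp (ContinuousLinearMap.fst ℝ _ _)) 0 := by
      have h := (hasStrictFDerivAt_exp_zero (𝕂 := ℝ) (𝔸 := M)).comp (0 : lieAlg G × H)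
        ((lieAlg G).subtypeL.comp (ContinuousLinearMap.fst ℝ _ H)).hasStrictFDerivAt
      exact h
    have h2 : HasStrictFDerivAt (fun p : lieAlg G × H => exp (p.2 : M))
        (H.subtypeL.comp (ContinuousLinearMap.snd ℝ _ _)) 0 := by
      have h := (hasStrictFDerivAt_exp_zero (𝕂 := ℝ) (𝔸 := M)).comp (0 : lieAlg G × H)
        (H.subtypeL.comp (ContinuousLinearMap.snd ℝ (lieAlg G) H)).hasStrictFDerivAt
      exact h
    have h := h1.mul' h2
    refine h.congr_fderiv ?_
    ext p <;> simp [e]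
  intro s hs
  rw [mem_map, (Topology.IsInducing.subtypeVal).nhds_eq_comap] at hs
  obtain ⟨N, hN, hNs⟩ := hs
  have hP : ∀ᶠ p in 𝓝 (0 : lieAlg G × H),
      (p.1 : M) ∈ N ∧ (expUnit (p.2 : M) ∈ G → (p.2 : M) = 0) := by
    have c1 : Tendsto (fun p : lieAlg G × H => (p.1 : M)) (𝓝 0) (𝓝 0) := by
      have : Continuous fun p : lieAlg G × H => (p.1 : M) := by fun_prop
      simpa using this.tendsto 0
    have c2 : Tendsto (fun p : lieAlg G × H => (p.2 : M)) (𝓝 0) (𝓝 0) := by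
      have : Continuous fun p : lieAlg G × H => (p.2 : M) := by fun_prop
      simpa using this.tendsto 0
    filter_upwards [c1.eventually hN, c2.eventually (eventually_eq_zero_of_expUnit_mem hH.disjoint)]
      with p hp1 hp2
    exact ⟨hp1, hp2 p.2.2⟩
  have himg := image_mem_map (m := Φ) hP
  rw [hΦ.map_nhds_eq_of_equiv] at himg
  have hΦ0 : Φ 0 = toMat (1 : G) := by simp [Φ]
  rw [hΦ0] at himg
  have hmem := isInducing_toMat.continuous.continuousAt.preimage_mem_nhds himg
  filter_upwards [hmem] with g ⟨p, ⟨hp1, hp2⟩, hpg⟩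
  have hg : (g : Mˣ) = expUnit (p.1 : M) * expUnit (p.2 : M) := Units.ext hpg.symm
  have hp0 : (p.2 : M) = 0 := by
    refine hp2 ?_
    have : expUnit (p.2 : M) = (expUnit (p.1 : M))⁻¹ * g := by rw [hg]; group
    rw [this]
    exact G.mul_mem (G.inv_mem (expUnit_mem p.1)) g.2
  have hg' : g = lieExp p.1 := by
    refine Subtype.ext ?_
    rw [hg, hp0, expUnit_zero, mul_one]; rfl
  rw [hg']
  exact hNs hp1

/-! ### Abelian groups and commutative Lie algebras -/

/-- If `𝔤` is commutative, the Lie exponential is onto the connected group `G`: its range is an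
open subgroup. -/
theorem lieExp_surjective (hconn : ConnectedSpace G)
    (hc : ∀ X Y : lieAlg G, (X : M) * Y = Y * X) :
    Function.Surjective (lieExp : lieAlg G → G) := by
  have : CompleteSpace M := FiniteDimensional.complete ℝ M
  let H : Subgroup G :=
    { carrier := Set.range lieExp
      one_mem' := ⟨0, lieExp_zero⟩
      mul_mem' := by
        rintro _ _ ⟨X, rfl⟩ ⟨Y, rfl⟩
        exact ⟨X + Y, lieExp_add (hc X Y)⟩
      inv_mem' := by
        rintro _ ⟨X, rfl⟩
        exact ⟨-X, lieExp_neg X⟩ }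
  have hmem : (H : Set G) ∈ 𝓝 (1 : G) :=
    nhds_one_le_map_lieExp (mem_map.2 (univ_mem' fun X => ⟨X, rfl⟩))
  have ho : IsOpen (H : Set G) := H.isOpen_of_mem_nhds hmem
  have hu := IsClopen.eq_univ ⟨H.isClosed_of_isOpen ho, ho⟩ ⟨1, H.one_mem⟩
  exact Set.range_eq_univ.1 hu

theorem mul_comm_of_lieAlg_comm (hconn : ConnectedSpace G)
    (hc : ∀ X Y : lieAlg G, (X : M) * Y = Y * X) (g h : G) : g * h = h * g := by
  obtain ⟨X, rfl⟩ := lieExp_surjective hconn hc g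
  obtain ⟨Y, rfl⟩ := lieExp_surjective hconn hc h
  rw [← lieExp_add (hc X Y), ← lieExp_add (hc Y X), add_comm]

end MatrixLieGroup

namespace MatrixLieGroup

open NormedSpace

/-! ### One-parameter groups of isometries -/

section isometries

variable {E : Type*} [NormedAddCommGroup E] [NormedSpace ℝ E] [FiniteDimensional ℝ E]
  {b : E →ₗ[ℝ] E →ₗ[ℝ] ℝ} {R : ℝ → E →ₗ[ℝ] E} {T : E →ₗ[ℝ] E}

theorem skew_of_isometry (h0 : ∀ Y, R 0 Y = Y)
    (hR : ∀ t Y, HasDerivAt (fun s => R s Y) (R t (T Y)) t)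
    (hiso : ∀ t X Y, b (R t X) (R t Y) = b X Y) (X Y : E) : b (T X) Y = -b X (T Y) := by
  let B := LinearMap.toContinuousBilinearMap b
  have h := B.hasDerivAt_of_bilinear (fun _ => hR 0 X) fun _ => hR 0 Y
  have e : (fun t => B (R t X) (R t Y)) = fun _ => b X Y := funext fun t => hiso t X Y
  rw [e] at h
  have h1 := h.unique (hasDerivAt_const _ _)
  simp only [h0] at h1
  have h2 : b X (T Y) + b (T X) Y = 0 := h1
  linarith

/-- The curve `t ↦ R t Y` has constant speed `|T Y|`. If its chord from time `0` to time `1` has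
that same length, then the curve is a line on this interval, so `T (T Y) = 0`; as `T` is skew,
`T Y = 0`. -/
theorem eq_zero_of_norm_eq_chord (hpos : ∀ X, X ≠ 0 → 0 < b X X)
    (hsymm : ∀ X Y, b X Y = b Y X) (h0 : ∀ Y, R 0 Y = Y)
    (hR : ∀ t Y, HasDerivAt (fun s => R s Y) (R t (T Y)) t)
    (hiso : ∀ t X Y, b (R t X) (R t Y) = b X Y)
    {Y : E} (h : b (T Y) (T Y) = b (R 1 Y - Y) (R 1 Y - Y)) : T Y = 0 := by
  have hzero : ∀ X, b X X = 0 → X = 0 := fun X hX => by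
    by_contra hne
    exact (hpos X hne).ne' hX
  have hnn : ∀ X, 0 ≤ b X X := fun X => by
    rcases eq_or_ne X 0 with rfl | hne
    · simp
    · exact (hpos X hne).le
  set w := R 1 Y - Y with hw
  have hsub : ∀ t, b (R t (T Y) - w) (R t (T Y) - w) = 2 * (b w w - b (R t (T Y)) w) := fun t => by
    simp only [map_sub, LinearMap.sub_apply, hiso, h, hsymm w (R t (T Y))]
    ring
  -- the defect in the Cauchy-Schwarz inequality, integrated up to time `t`
  let q : ℝ → ℝ := fun t => t * b w w - b (R t Y) w
  have hq : ∀ t, HasDerivAt q (b w w - b (R t (T Y)) w) t := fun t => by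
    have h1 : HasDerivAt (fun s => b (R s Y) w) (b (R t (T Y)) w) t :=
      (LinearMap.toContinuousLinearMap (b.flip w)).hasFDerivAt.comp_hasDerivAt t (hR t Y)
    exact (((hasDerivAt_id t).mul_const (b w w)).sub h1).congr_deriv (by simp)
  have hmono : Monotone q := monotone_of_deriv_nonneg (fun t => (hq t).differentiableAt) fun t => by
    rw [(hq t).deriv]
    have := hnn (R t (T Y) - w)
    rw [hsub] at this
    linarith
  have hq01 : q 0 = q 1 := by
    have : R 1 Y = w + Y := by rw [hw]; abel
    simp [q, h0, this]
  have hline : ∀ t ∈ Set.Ioo (0 : ℝ) 1, R t (T Y) = w := fun t ht => by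
    have hc : q =ᶠ[𝓝 t] fun _ => q 0 := by
      filter_upwards [Ioo_mem_nhds ht.1 ht.2] with s hs
      exact le_antisymm ((hmono hs.2.le).trans hq01.ge) (hmono hs.1.le)
    have h1 := ((hq t).congr_of_eventuallyEq hc.symm).unique (hasDerivAt_const t (q 0))
    exact sub_eq_zero.1 (hzero _ (by rw [hsub, h1, mul_zero]))
  have hTT : T (T Y) = 0 := by
    have hc : (fun s => R s (T Y)) =ᶠ[𝓝 (1 / 2 : ℝ)] fun _ => w := by
      filter_upwards [Ioo_mem_nhds (by norm_num : (0 : ℝ) < 1 / 2)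
        (by norm_num : (1 / 2 : ℝ) < 1)] with s hs
      exact hline s hs
    have h1 := ((hR (1 / 2) (T Y)).congr_of_eventuallyEq hc.symm).unique (hasDerivAt_const _ w)
    refine hzero _ ?_
    rw [← hiso (1 / 2), h1, map_zero]
  refine hzero _ ?_
  rw [skew_of_isometry h0 hR hiso, hTT, map_zero, neg_zero]

end isometries

variable {M : Type*} [NormedRing M] [NormedAlgebra ℝ M]

/-! ### The adjoint representation -/

section adjoint

variable {G : ClosedSubgroup Mˣ}

/-- The adjoint representation `Ad_g Y = g Y g⁻¹` of `G` on `𝔤`. -/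
def Ad (g : G) : lieAlg G →ₗ[ℝ] lieAlg G where
  toFun Y := ⟨toMat g * Y * toMat g⁻¹, by simpa using mul_mul_mem_tangentSpace g 1 g⁻¹ Y.2⟩
  map_add' X Y := by ext; simp [mul_add, add_mul]
  map_smul' c Y := by ext; simp

theorem coe_Ad (g : G) (Y : lieAlg G) : (Ad g Y : M) = toMat g * Y * toMat g⁻¹ := rfl

theorem Ad_Ad (g h : G) (Y : lieAlg G) : Ad g (Ad h Y) = Ad (g * h) Y := by
  ext; simp [coe_Ad, mul_assoc]

theorem Ad_one (Y : lieAlg G) : Ad 1 Y = Y := by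
  ext; simp [coe_Ad]

theorem inner_congr (α : RiemannianMetric G) {B C : G} (h : B = C) {X Y : tangentSpace G B}
    {X' Y' : tangentSpace G C} (hX : (X : M) = X') (hY : (Y : M) = Y') :
    α.inner B X Y = α.inner C X' Y' := by
  subst h
  rw [Subtype.ext hX, Subtype.ext hY]

theorem inner_Ad {α : RiemannianMetric G} (hα : α.IsBiInvariant) (g : G) (X Y : lieAlg G) :
    α.inner 1 (Ad g X) (Ad g Y) = α.inner 1 X Y := by
  rw [← hα.1 g 1 X Y, ← hα.2 g⁻¹ (g * 1)]
  exact inner_congr α (by simp) rfl rfl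

theorem phi_smul (T : Module.End ℝ (lieAlg G)) (c : ℝ) (Y : lieAlg G) :
    phi T (c • Y) = c • phi T Y := by
  simp only [phi, map_smul, smul_comm _ c]
  exact tsum_const_smul'' c

theorem phi_zero (Y : lieAlg G) : phi 0 Y = Y := by
  rw [phi, tsum_eq_single 0 fun k hk => by simp [hk]]
  simp

theorem toLieAlg_smul (B : G) (c : ℝ) (U : tangentSpace G B) :
    toLieAlg B (c • U) = c • toLieAlg B U := by
  ext; simp [toLieAlg]

end adjoint

variable [FiniteDimensional ℝ M]

/-- A subspace is a retract of the ambient space by a continuous linear map; derivatives of curves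
in `p` can thus be computed in `M`. -/
theorem exists_projection (p : Submodule ℝ M) : ∃ P : M →L[ℝ] p, ∀ x : p, P x = x := by
  obtain ⟨f, hf⟩ := p.subtype.exists_leftInverse_of_injective p.ker_subtype
  exact ⟨LinearMap.toContinuousLinearMap f, fun x => LinearMap.congr_fun hf x⟩

theorem hasDerivAt_subtype {p : Submodule ℝ M} {f : ℝ → p} {f' : p} {t : ℝ}
    (h : HasDerivAt (fun s => (f s : M)) (f' : M) t) : HasDerivAt f f' t := by
  obtain ⟨P, hP⟩ := exists_projection p
  have := P.hasFDerivAt.comp_hasDerivAt t h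
  simpa only [Function.comp_def, hP] using this

/-- The multiplication operator `V ↦ X V - V X` exponentiates to conjugation by `e^X`. -/
theorem exp_mulLeft_sub_mulRight_apply (X V : M) :
    exp (ContinuousLinearMap.mul ℝ M X - (ContinuousLinearMap.mul ℝ M).flip X) V =
      exp X * V * exp (-X) := by
  have : CompleteSpace M := FiniteDimensional.complete ℝ M
  let _ : NormedAlgebra ℚ (M →L[ℝ] M) := NormedAlgebra.restrictScalars ℚ ℝ (M →L[ℝ] M)
  have hl : ∀ X V : M, exp (ContinuousLinearMap.mul ℝ M X) V = exp X * V := fun X V => by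
    have h1 := (exp_series_hasSum_exp' (𝕂 := ℝ) (ContinuousLinearMap.mul ℝ M X)).mapL
      (ContinuousLinearMap.apply ℝ M V)
    have h2 := (exp_series_hasSum_exp' (𝕂 := ℝ) X).mul_right V
    refine h1.unique (h2.congr_fun fun k => ?_)
    have : ∀ k : ℕ, (ContinuousLinearMap.mul ℝ M X ^ k) V = X ^ k * V := fun k => by
      induction k with
      | zero => simp
      | succ k ih =>
        rw [pow_succ', pow_succ', mul_assoc, ← ih]
        rfl
    simp [this]
  have hr : ∀ X V : M, exp ((ContinuousLinearMap.mul ℝ M).flip X) V = V * exp X := fun X V => by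
    have h1 := (exp_series_hasSum_exp' (𝕂 := ℝ) ((ContinuousLinearMap.mul ℝ M).flip X)).mapL
      (ContinuousLinearMap.apply ℝ M V)
    have h2 := (exp_series_hasSum_exp' (𝕂 := ℝ) X).mul_left V
    refine h1.unique (h2.congr_fun fun k => ?_)
    have : ∀ k : ℕ, ((ContinuousLinearMap.mul ℝ M).flip X ^ k) V = V * X ^ k := fun k => by
      induction k with
      | zero => simp
      | succ k ih =>
        rw [pow_succ', pow_succ, ← mul_assoc, ← ih]
        rfl
    simp [this]
  have hcomm : Commute (ContinuousLinearMap.mul ℝ M X)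
      ((ContinuousLinearMap.mul ℝ M).flip (-X)) := by
    ext V; simp [mul_assoc]
  rw [sub_eq_add_neg, ← map_neg, exp_add_of_commute hcomm, mul_assoc, ← hr, ← hl]
  rfl

variable {G : ClosedSubgroup Mˣ}

theorem coe_ad (X Y : lieAlg G) : (ad X Y : M) = X * Y - Y * X := rfl

theorem ad_neg (X : lieAlg G) : ad (-X) = -ad X := by
  ext Y; simp [coe_ad]; abel

/-- `e^{ad_X} = Ad_{e^X}`. -/
theorem hasSum_ad_pow (X V : lieAlg G) :
    HasSum (fun k : ℕ => ((k ! : ℕ) : ℝ)⁻¹ • (ad X ^ k) V) (Ad (lieExp X) V) := by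
  have : CompleteSpace M := FiniteDimensional.complete ℝ M
  have hi : Topology.IsInducing (lieAlg G).subtype := Topology.IsInducing.subtypeVal
  rw [← hi.hasSum_iff]
  have h := (exp_series_hasSum_exp' (𝕂 := ℝ)
    (ContinuousLinearMap.mul ℝ M (X : M) - (ContinuousLinearMap.mul ℝ M).flip (X : M))).mapL
      (ContinuousLinearMap.apply ℝ M (V : M))
  have e : ∀ k : ℕ, ((ContinuousLinearMap.mul ℝ M (X : M) -
      (ContinuousLinearMap.mul ℝ M).flip (X : M)) ^ k) (V : M) = ((ad X ^ k) V : lieAlg G) :=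
    fun k => by
      induction k with
      | zero => simp
      | succ k ih =>
        rw [pow_succ', pow_succ']
        simp only [ContinuousLinearMap.mul_def, ContinuousLinearMap.comp_apply, ih]
        rfl
  have hlim : exp (ContinuousLinearMap.mul ℝ M (X : M) -
      (ContinuousLinearMap.mul ℝ M).flip (X : M)) (V : M) = Ad (lieExp X) V :=
    exp_mulLeft_sub_mulRight_apply (X : M) (V : M)
  rw [ContinuousLinearMap.apply_apply, hlim] at h
  refine h.congr_fun fun k => ?_
  simp [e]

/-- `φ(T) T = 1 - e^{-T}` for `T = ad_{-A}`. -/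
theorem phi_ad_neg_ad (A V : lieAlg G) : phi (ad (-A)) (ad A V) = Ad (lieExp A) V - V := by
  have h := (hasSum_nat_add_iff' 1).2 (hasSum_ad_pow A V)
  simp only [Finset.sum_range_one, Nat.factorial_zero, Nat.cast_one, inv_one, pow_zero, one_smul,
    Module.End.one_apply] at h
  rw [phi, ad_neg, neg_neg, ← h.tsum_eq]
  simp only [pow_succ, Module.End.mul_apply]

theorem ad_Ad_lieExp (A V : lieAlg G) : ad A (Ad (lieExp A) V) = Ad (lieExp A) (ad A V) := by
  have h1 : (A : M) * exp (A : M) = exp (A : M) * A := (Commute.refl (A : M)).exp_right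
  have h2 : exp (-(A : M)) * A = A * exp (-(A : M)) :=
    (Commute.refl (A : M)).neg_right.exp_right.symm
  ext
  simp only [coe_ad, coe_Ad, ← lieExp_neg, toMat_lieExp, Submodule.coe_neg]
  rw [mul_sub, sub_mul]
  simp only [mul_assoc, h2]
  simp only [← mul_assoc, h1]

/-- The differential of the exponential at `A`, along the orbit of `A` under conjugation. -/
theorem fderiv_exp_commutator (A Z : M) :
    fderiv ℝ exp A (A * Z - Z * A) = exp A * Z - Z * exp A := by
  have : CompleteSpace M := FiniteDimensional.complete ℝ M
  let _ : NormedAlgebra ℚ M := NormedAlgebra.restrictScalars ℚ ℝ M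
  have hconj : ∀ X : M, HasDerivAt (fun s : ℝ => exp (-(s • Z)) * X * exp (s • Z))
      (X * Z - Z * X) 0 := fun X => by
    have h1 : HasDerivAt (fun s : ℝ => exp (-(s • Z))) (-Z) 0 := by
      simpa only [smul_neg] using hasDerivAt_exp_smul_zero (-Z)
    have h := (h1.mul_const X).mul (hasDerivAt_exp_smul_zero Z)
    refine h.congr_deriv ?_
    simp
    abel
  have h2 : HasFDerivAt exp (fderiv ℝ exp A) (exp (-((0 : ℝ) • Z)) * A * exp ((0 : ℝ) • Z)) := by
    simpa using (differentiableAt_exp A).hasFDerivAt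
  refine (h2.comp_hasDerivAt (0 : ℝ) (hconj A)).unique ?_
  have e : (exp ∘ fun s : ℝ => exp (-(s • Z)) * A * exp (s • Z)) =
      fun s => exp (-(s • Z)) * exp A * exp (s • Z) :=
    funext fun s => exp_units_conj' (expUnit (s • Z)) A
  rw [e]
  exact hconj (exp A)

theorem hasDerivAt_Ad (A Y : lieAlg G) (t : ℝ) :
    HasDerivAt (fun s : ℝ => Ad (lieExp (s • A)) Y) (Ad (lieExp (t • A)) (ad A Y)) t := by
  refine hasDerivAt_subtype ?_
  simp only [coe_Ad, ← lieExp_neg, toMat_lieExp, Submodule.coe_neg, Submodule.coe_smul, coe_ad]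
  have h1 := hasDerivAt_exp_smul (A : M) t
  have h2 := hasDerivAt_exp_smul (-(A : M)) t
  simp only [smul_neg] at h2
  have h := (h1.mul_const (Y : M)).mul h2
  refine h.congr_deriv ?_
  have e : exp (-(t • (A : M))) * -(A : M) = -(A : M) * exp (-(t • (A : M))) :=
    (((Commute.refl (A : M)).smul_right t).neg_right.neg_left).exp_right.symm
  rw [e]
  noncomm_ring

section metric

variable {α : RiemannianMetric G}

theorem inner_ad (hα : α.IsBiInvariant) (A X Y : lieAlg G) :
    α.inner 1 (ad A X) Y = -α.inner 1 X (ad A Y) :=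
  skew_of_isometry (R := fun t => Ad (lieExp (t • A))) (fun Y => by simp [lieExp_zero, Ad_one])
    (fun t Y => hasDerivAt_Ad A Y t) (fun t => inner_Ad hα _) X Y

theorem ad_eq_zero_of_inner_eq (hα : α.IsBiInvariant) {A Y : lieAlg G}
    (h : α.inner 1 (ad A Y) (ad A Y) =
      α.inner 1 (Ad (lieExp A) Y - Y) (Ad (lieExp A) Y - Y)) : ad A Y = 0 :=
  eq_zero_of_norm_eq_chord (R := fun t => Ad (lieExp (t • A))) (α.pos 1) (α.symm 1)
    (fun Y => by simp [lieExp_zero, Ad_one]) (fun t Y => hasDerivAt_Ad A Y t)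
    (fun t => inner_Ad hα _) (by simpa using h)

end metric

end MatrixLieGroup

namespace MatrixLieGroup

open NormedSpace

variable {M : Type*} [NormedRing M] [NormedAlgebra ℝ M] [FiniteDimensional ℝ M]
  {G : ClosedSubgroup Mˣ}

/-! ### Retractions and local isometries force the adjoint representation to vanish -/

/-- At a retraction, `φ(ad_{-A})` inverts the left-trivialized differential of `exp` at `A`. -/
theorem fderiv_exp_phi {A : lieAlg G} (h : IsRetractionAt (lieExp A) (stepUpdate A))
    (Y : lieAlg G) : fderiv ℝ exp (A : M) (phi (ad (-A)) Y : lieAlg G) = exp (A : M) * Y := by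
  let U : tangentSpace G (lieExp A) := ⟨toMat (lieExp A) * Y, by
    simpa using mul_mul_mem_tangentSpace (lieExp A) 1 1 Y.2⟩
  have hU : toLieAlg (lieExp A) U = Y := by
    ext
    change toMat (lieExp A)⁻¹ * (toMat (lieExp A) * (Y : M)) = Y
    rw [← mul_assoc, toMat_inv_mul, one_mul]
  have h1 : HasDerivAt (fun s : ℝ => s • U) U 0 := by
    simpa using (hasDerivAt_id (0 : ℝ)).smul_const U
  have h2 : HasFDerivAt (fun V => toMat (stepUpdate A V)) (tangentSpace G (lieExp A)).subtypeL
      ((0 : ℝ) • U) := by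
    rw [zero_smul]; exact h.2
  have h3 := h2.comp_hasDerivAt (0 : ℝ) h1
  have e : ((fun V => toMat (stepUpdate A V)) ∘ fun s : ℝ => s • U) =
      fun s : ℝ => exp ((A : M) + s • (phi (ad (-A)) Y : lieAlg G)) := by
    funext s
    simp only [Function.comp_apply, stepUpdate, toLieAlg_smul, hU, phi_smul, toMat_lieExp,
      Submodule.coe_add, Submodule.coe_smul]
  rw [e] at h3
  have h4 : HasDerivAt (fun s : ℝ => (A : M) + s • (phi (ad (-A)) Y : M))
      (phi (ad (-A)) Y : lieAlg G) 0 := by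
    simpa using ((hasDerivAt_id (0 : ℝ)).smul_const (phi (ad (-A)) Y : M)).const_add (A : M)
  have h5 : HasFDerivAt exp (fderiv ℝ exp (A : M))
      ((A : M) + (0 : ℝ) • (phi (ad (-A)) Y : M)) := by
    simpa using (differentiableAt_exp (A : M)).hasFDerivAt
  exact (h5.comp_hasDerivAt (0 : ℝ) h4).unique h3

theorem exp_commutator (A Z : lieAlg G) : exp (A : M) * Z - Z * exp (A : M) =
    exp (A : M) * ((Z - Ad (lieExp A)⁻¹ Z : lieAlg G) : M) := by
  have h : exp (A : M) * toMat (lieExp A)⁻¹ = 1 := toMat_mul_inv (lieExp A)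
  rw [Submodule.coe_sub, coe_Ad, mul_sub, ← mul_assoc, ← mul_assoc, h, one_mul, inv_inv,
    toMat_lieExp]

/-- With `T = ad_A`, the identity `φ(T) φ(-T) = 1` is tested on `T²` only, where it reads
`T² = e^T + e^{-T} - 2`; pairing with `W` gives `|T W| = |e^T W - W|`. -/
theorem ad_eq_zero_of_isRetractionAt {α : RiemannianMetric G} (hα : α.IsBiInvariant)
    {A : lieAlg G} (h : IsRetractionAt (lieExp A) (stepUpdate A)) (W : lieAlg G) :
    ad A W = 0 := by
  refine ad_eq_zero_of_inner_eq hα ?_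
  set Z := Ad (lieExp A) W - W with hZ
  have h1 := fderiv_exp_phi h (ad A (ad A W))
  rw [phi_ad_neg_ad, ← ad_Ad_lieExp, ← map_sub, ← hZ, coe_ad, fderiv_exp_commutator,
    exp_commutator] at h1
  have h2 : Z - Ad (lieExp A)⁻¹ Z = ad A (ad A W) := by
    ext
    have hu : exp (-(A : M)) * exp (A : M) = 1 := by simpa using exp_mul_exp_neg (-(A : M))
    simpa only [← mul_assoc, hu, one_mul] using congrArg (exp (-(A : M)) * ·) h1
  have h3 : α.inner 1 (Ad (lieExp A)⁻¹ Z) W = α.inner 1 Z (Ad (lieExp A) W) := by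
    rw [← inner_Ad hα (lieExp A), Ad_Ad, mul_inv_cancel, Ad_one]
  have h4 := inner_ad hα A (ad A W) W
  rw [← h2, map_sub, LinearMap.sub_apply, h3] at h4
  have h5 : α.inner 1 Z Z = α.inner 1 Z (Ad (lieExp A) W) - α.inner 1 Z W := by
    rw [← map_sub]
  linarith

theorem ad_eq_zero_of_isLocalIsometry {α : RiemannianMetric G} (hα : α.IsBiInvariant)
    (h : IsLocalIsometry α (lieExp (G := G))) (A W : lieAlg G) : ad A W = 0 := by
  refine ad_eq_zero_of_inner_eq hα ?_
  obtain ⟨-, D, hD, hiso⟩ := h A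
  have h1 : HasFDerivAt (fun X : lieAlg G => toMat (lieExp X))
      ((fderiv ℝ exp (A : M)).comp (lieAlg G).subtypeL) A :=
    (differentiableAt_exp (A : M)).hasFDerivAt.comp A (lieAlg G).subtypeL.hasFDerivAt
  set V := W - Ad (lieExp A)⁻¹ W with hV
  have h2 : (D (ad A W) : M) = toMat (lieExp A) * V := by
    have := DFunLike.congr_fun (hD.unique h1) (ad A W)
    refine this.trans ?_
    change fderiv ℝ exp (A : M) (A * W - W * A) = _
    rw [fderiv_exp_commutator, exp_commutator, toMat_lieExp]
  have h3 : Ad (lieExp A) W - W = Ad (lieExp A) V := by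
    rw [hV, map_sub, Ad_Ad, mul_inv_cancel, Ad_one]
  rw [← hiso, h3, inner_Ad hα, ← hα.1 (lieExp A) 1]
  exact inner_congr α (mul_one _).symm h2 h2

theorem ad_eq_zero_iff {A W : lieAlg G} : ad A W = 0 ↔ (A : M) * W = W * A := by
  rw [← Subtype.coe_inj, coe_ad, Submodule.coe_zero, sub_eq_zero]

/-! ### The retraction by left translation of the exponential -/

/-- The retraction `(B, U) ↦ B exp (B⁻¹ U)`. -/
noncomputable def expRetraction (B : G) (U : tangentSpace G B) : G :=
  B * lieExp (toLieAlg B U)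

theorem isRetraction_expRetraction : IsRetraction (expRetraction (G := G)) := by
  have : CompleteSpace M := FiniteDimensional.complete ℝ M
  intro B
  constructor
  · have : toLieAlg B (0 : tangentSpace G B) = 0 := by ext; simp [toLieAlg]
    rw [expRetraction, this, lieExp_zero, mul_one]
  · let L : tangentSpace G B →L[ℝ] M :=
      (ContinuousLinearMap.mul ℝ M (toMat B⁻¹)).comp (tangentSpace G B).subtypeL
    have h1 : HasFDerivAt exp (1 : M →L[ℝ] M) (L 0) := by
      rw [map_zero]; exact hasFDerivAt_exp_zero
    have h2 := (ContinuousLinearMap.mul ℝ M (toMat B)).hasFDerivAt.comp (0 : tangentSpace G B)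
      (h1.comp (0 : tangentSpace G B) L.hasFDerivAt)
    refine h2.congr_fderiv ?_
    ext U
    change toMat B * (toMat B⁻¹ * (U : M)) = U
    rw [← mul_assoc, toMat_mul_inv, one_mul]

theorem stepUpdate_eq_expRetraction (hc : ∀ X Y : lieAlg G, (X : M) * Y = Y * X)
    (A : lieAlg G) : stepUpdate A = expRetraction (lieExp A) := by
  funext U
  have h0 : ad (-A) = 0 := LinearMap.ext fun W => ad_eq_zero_iff.2 (hc _ _)
  rw [stepUpdate, h0, phi_zero, lieExp_add (hc _ _), expRetraction]

/-! ### The exponential of an abelian group is a local isometry -/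

/-- A logarithm near `1`: analytic, and left inverse to the exponential near `0`. -/
theorem exists_log : ∃ ψ : M → M, (∀ᶠ m in 𝓝 (1 : M), ContDiffAt ℝ ∞ ψ m) ∧
    ∀ᶠ X in 𝓝 (0 : M), ψ (exp X) = X := by
  have : CompleteSpace M := FiniteDimensional.complete ℝ M
  have h1 : HasFDerivAt exp ((ContinuousLinearEquiv.refl ℝ M : M ≃L[ℝ] M) : M →L[ℝ] M) (0 : M) :=
    hasFDerivAt_exp_zero
  have h2 : ContDiffAt ℝ ω exp (0 : M) := contDiff_exp.contDiffAt
  refine ⟨h2.localInverse h1 (by simp), ?_, ?_⟩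
  · have h3 := h2.to_localInverse h1 (by simp)
    rw [exp_zero] at h3
    filter_upwards [h3.eventually (by simp)] with m hm
    exact hm.of_le le_top
  · exact (h2.hasStrictFDerivAt' h1 (by simp)).eventually_left_inverse

theorem nhds_lieExp_le (hc : ∀ X Y : lieAlg G, (X : M) * Y = Y * X) (A : lieAlg G) :
    𝓝 (lieExp A) ≤ map lieExp (𝓝 A) := by
  have h1 : map (fun X => A + X) (𝓝 (0 : lieAlg G)) = 𝓝 A := by
    simp
  have h2 : map (fun g => lieExp A * g) (𝓝 (1 : G)) = 𝓝 (lieExp A) :=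
    map_mul_left_nhds_one (lieExp A)
  rw [← h1, ← h2, map_map]
  have e : (lieExp ∘ fun X => A + X) = (fun g => lieExp A * g) ∘ lieExp :=
    funext fun X => lieExp_add (hc A X)
  rw [e, ← map_map]
  exact map_mono nhds_one_le_map_lieExp

theorem isLocalDiffeoAt_lieExp (hc : ∀ X Y : lieAlg G, (X : M) * Y = Y * X) (A : lieAlg G) :
    IsLocalDiffeoAt lieExp A := by
  obtain ⟨ψ, hψ, hinv⟩ := exists_log (M := M)
  obtain ⟨P, hP⟩ := exists_projection (lieAlg G)
  have hexp : Tendsto exp (𝓝 (0 : M)) (𝓝 1) := by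
    simpa using (contDiff_exp (M := M) (n := 0)).continuous.tendsto 0
  obtain ⟨N, hN, hNo, h0⟩ := eventually_nhds_iff.1 ((hexp.eventually hψ).and hinv)
  have hsplit : ∀ X : lieAlg G,
      toMat (lieExp A)⁻¹ * toMat (lieExp X) = exp ((X - A : lieAlg G) : M) := fun X => by
    rw [← lieExp_neg, ← toMat_mul, ← lieExp_add (hc _ _), toMat_lieExp, neg_add_eq_sub]
  let V : Set (lieAlg G) := {X | ((X - A : lieAlg G) : M) ∈ N}
  have hleft : ∀ X ∈ V, A + P (ψ (toMat (lieExp A)⁻¹ * toMat (lieExp X))) = X := fun X hX => by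
    rw [hsplit, (hN _ hX).2, hP, add_sub_cancel]
  have hVo : IsOpen V := hNo.preimage (by fun_prop)
  refine ⟨V, lieExp '' V, hVo, by simpa [V] using h0, ?_, ?_, ?_,
    fun m => A + P (ψ (toMat (lieExp A)⁻¹ * m)), ?_, hleft⟩
  · rw [isOpen_iff_mem_nhds]
    rintro _ ⟨X, hX, rfl⟩
    exact nhds_lieExp_le hc X (image_mem_map (hVo.mem_nhds hX))
  · refine Set.InjOn.bijOn_image fun X hX Y hY hXY => ?_
    rw [← hleft X hX, hXY, hleft Y hY]
  · exact (contDiff_exp.comp (lieAlg G).subtypeL.contDiff).contDiffOn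
  · rintro _ ⟨X, hX, rfl⟩
    have h1 : ContDiffAt ℝ ∞ ψ (toMat (lieExp A)⁻¹ * toMat (lieExp X)) := by
      rw [hsplit]; exact (hN _ hX).1
    exact contDiffAt_const.add (P.contDiff.contDiffAt.comp _
      (h1.comp _ (contDiffAt_const.mul contDiffAt_id)))

theorem isLocalIsometry_lieExp {α : RiemannianMetric G} (hα : α.IsBiInvariant)
    (hc : ∀ X Y : lieAlg G, (X : M) * Y = Y * X) : IsLocalIsometry α (lieExp (G := G)) := by
  have : CompleteSpace M := FiniteDimensional.complete ℝ M
  intro A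
  refine ⟨isLocalDiffeoAt_lieExp hc A, ?_⟩
  obtain ⟨P, hP⟩ := exists_projection (tangentSpace G (lieExp A))
  -- `exp (A + X) = e^A exp X`, so the differential at `A` is the left translation by `e^A`
  let D : lieAlg G →L[ℝ] tangentSpace G (lieExp A) :=
    P.comp ((ContinuousLinearMap.mul ℝ M (toMat (lieExp A))).comp (lieAlg G).subtypeL)
  have hD : ∀ X : lieAlg G, (D X : M) = toMat (lieExp A) * X := fun X => by
    have hm : toMat (lieExp A) * (X : M) ∈ tangentSpace G (lieExp A) := by
      simpa using mul_mul_mem_tangentSpace (lieExp A) 1 1 X.2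
    exact congrArg Subtype.val (hP ⟨_, hm⟩)
  refine ⟨D, ?_, fun X Y => ?_⟩
  · have h1 : HasFDerivAt (fun X : lieAlg G => ((X - A : lieAlg G) : M)) (lieAlg G).subtypeL A :=
      (lieAlg G).subtypeL.hasFDerivAt.comp A ((hasFDerivAt_id A).sub_const A)
    have h2 : HasFDerivAt exp (1 : M →L[ℝ] M) ((A - A : lieAlg G) : M) := by
      rw [sub_self]; exact hasFDerivAt_exp_zero
    have h3 := (ContinuousLinearMap.mul ℝ M (toMat (lieExp A))).hasFDerivAt.comp A (h2.comp A h1)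
    have e : (fun X : lieAlg G => toMat (lieExp X)) =
        fun X : lieAlg G => toMat (lieExp A) * exp ((X - A : lieAlg G) : M) := by
      funext X
      rw [← toMat_lieExp, ← toMat_mul, ← lieExp_add (hc _ _), add_sub_cancel]
    rw [e]
    refine h3.congr_fderiv ?_
    ext X
    exact (hD X).symm
  · rw [← hα.1 (lieExp A) 1]
    exact inner_congr α (mul_one _).symm (hD X) (hD Y)

end MatrixLieGroup

/-! ### The equivalence -/

theorem mainTheorem1 (n : ℕ) (G : ClosedSubgroup (GL (Fin n) ℂ)) (hconn : ConnectedSpace G)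
    (α : MatrixLieGroup.RiemannianMetric G) (hα : α.IsBiInvariant) :
    List.TFAE [
      -- `G` is abelian
      ∀ g h : G, g * h = h * g,
      -- `r̂` is a retraction at every `(e^A, ·)`, `A ∈ 𝔤`
      ∀ A : MatrixLieGroup.lieAlg G,
        MatrixLieGroup.IsRetractionAt (MatrixLieGroup.lieExp A) (MatrixLieGroup.stepUpdate A),
      -- the formula for `r̂` gives a well-defined retraction `TG → G`
      ∃ r : (B : G) → MatrixLieGroup.tangentSpace G B → G,
        (∀ A : MatrixLieGroup.lieAlg G,
          r (MatrixLieGroup.lieExp A) = MatrixLieGroup.stepUpdate A) ∧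
        MatrixLieGroup.IsRetraction r,
      -- `r̂` is a retraction for some choice of a logarithm `A` of every `B ∈ G`
      ∃ r : (B : G) → MatrixLieGroup.tangentSpace G B → G,
        (∀ B : G, ∃ A : MatrixLieGroup.lieAlg G, MatrixLieGroup.lieExp A = B ∧
          r (MatrixLieGroup.lieExp A) = MatrixLieGroup.stepUpdate A) ∧
        MatrixLieGroup.IsRetraction r,
      -- the Lie exponential is a local isometry
      MatrixLieGroup.IsLocalIsometry α (MatrixLieGroup.lieExp (G := G))] := by
  have hne : (∀ A W : MatrixLieGroup.lieAlg G, MatrixLieGroup.ad A W = 0) →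
      ∀ g h : G, g * h = h * g := fun h =>
    MatrixLieGroup.mul_comm_of_lieAlg_comm hconn fun X Y =>
      MatrixLieGroup.ad_eq_zero_iff.1 (h X Y)
  tfae_have 1 → 5 := fun h =>
    MatrixLieGroup.isLocalIsometry_lieExp hα (MatrixLieGroup.lieAlg_comm_of_mul_comm h)
  tfae_have 5 → 1 := fun h => hne (MatrixLieGroup.ad_eq_zero_of_isLocalIsometry hα h)
  tfae_have 1 → 3 := fun h =>
    ⟨MatrixLieGroup.expRetraction, fun A => (MatrixLieGroup.stepUpdate_eq_expRetraction
      (MatrixLieGroup.lieAlg_comm_of_mul_comm h) A).symm,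
      MatrixLieGroup.isRetraction_expRetraction⟩
  tfae_have 3 → 2 := by
    rintro ⟨r, hr, hret⟩ A
    rw [← hr A]
    exact hret _
  tfae_have 2 → 1 := fun h =>
    hne fun A => MatrixLieGroup.ad_eq_zero_of_isRetractionAt hα (h A)
  tfae_have 1 → 4 := fun h => by
    have hc := MatrixLieGroup.lieAlg_comm_of_mul_comm h
    refine ⟨MatrixLieGroup.expRetraction, fun B => ?_,
      MatrixLieGroup.isRetraction_expRetraction⟩
    obtain ⟨A, rfl⟩ := MatrixLieGroup.lieExp_surjective hconn hc B
    exact ⟨A, rfl, (MatrixLieGroup.stepUpdate_eq_expRetraction hc A).symm⟩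
  -- every element of `G` has a logarithm that is central in the Lie algebra
  tfae_have 4 → 1 := by
    rintro ⟨r, hr, hret⟩ g h
    obtain ⟨A, rfl, hA⟩ := hr g
    obtain ⟨A', rfl, -⟩ := hr h
    have hAr : MatrixLieGroup.IsRetractionAt (MatrixLieGroup.lieExp A)
        (MatrixLieGroup.stepUpdate A) := hA ▸ hret _
    have hAA' := MatrixLieGroup.ad_eq_zero_iff.1
      (MatrixLieGroup.ad_eq_zero_of_isRetractionAt hα hAr A')
    rw [← MatrixLieGroup.lieExp_add hAA', ← MatrixLieGroup.lieExp_add hAA'.symm, add_comm]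
  tfae_finish
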